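/- Let $n\ge 1$, let $x_1,\dots,x_n\in\mathbb R^d$ with labels $y_1,\dots,y_n\in\{-1,1\}$, put $R=\max_i\|x_i\|_2$, and let $\lambda>0$. Let the loss be $\ell(z)=\log(1+e^z)$ (logistic regression) or $\ell(z)=\max(0,1+z)$ (SVM), and let the regularizer $r$ on $\mathbb R^d$ be $\|\cdot\|_1$, $\|\cdot\|_2$ or $\|\cdot\|_2^2$. For $\beta\in\mathbb R^d$ put $$f_i(\beta)=\ell(-y_i\,\beta\cdot x_i)+\frac{\lambda\, r(R\beta)}{n}.$$ A finite subcollection $C$ of $\{1,\dots,n\}$ (repetitions allowed) with weights $u_i\ge 0$ is an $\varepsilon$-coreset if $$\frac{\bigl|\sum_{i=1}^n f_i(\beta)-\sum_{i\in C}u_i f_i(\beta)\bigr|}{\sum_{i=1}^n f_i(\beta)}\le\varepsilon\qquad\text{for all }\beta\in\mathbb R^d .$$ Let $S'=\frac{12n}{\lambda}+6$; in particular $S'=12n^{1-\kappa}+6$ if $\lambda=n^\kappa$ with $0<\kappa<1$. Let $\varepsilon,\delta\in(0,1)$, and let $q$ be an integer with $$q\ \ge\ \frac{10S'}{\varepsilon^2}\Bigl((d+1)\log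 S'+\log\frac1\delta\Bigr).$$ Then $q$ points drawn independently and uniformly (with replacement) from $\{1,\dots,n\}$, each with weight $n/q$, form an $\varepsilon$-coreset with probability at least $1-\delta$. -/

import Mathlib

open MeasureTheory ProbabilityTheory

noncomputable section

namespace RLM

/-- The logistic loss `log (1 + exp z)`. -/
def logisticLoss (z : ℝ) : ℝ := Real.log (1 + Real.exp z)

/-- The hinge (soft margin SVM) loss `max (0, 1 + z)`. -/
def hingeLoss (z : ℝ) : ℝ := max 0 (1 + z)

/-- The 1-norm regularizer. -/
def oneNorm {d : ℕ} (β : EuclideanSpace ℝ (Fin d)) : ℝ := ∑ j, |β j|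

/-- The 2-norm regularizer. -/
def twoNorm {d : ℕ} (β : EuclideanSpace ℝ (Fin d)) : ℝ := ‖β‖

/-- The squared 2-norm regularizer. -/
def twoNormSq {d : ℕ} (β : EuclideanSpace ℝ (Fin d)) : ℝ := ‖β‖ ^ 2

/-- `R`, the maximum 2-norm of a data point. -/
def maxNorm {n d : ℕ} (x : Fin n → EuclideanSpace ℝ (Fin d)) : ℝ := ⨆ i, ‖x i‖

/-- `f_i(β) = ℓ(-y_i β·x_i) + λ r(R β) / n`, the contribution of point `i` to the objective. -/
def pointCost {n d : ℕ} (ℓ : ℝ → ℝ) (r : EuclideanSpace ℝ (Fin d) → ℝ) (lam : ℝ)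
    (x : Fin n → EuclideanSpace ℝ (Fin d)) (y : Fin n → ℝ)
    (i : Fin n) (β : EuclideanSpace ℝ (Fin d)) : ℝ :=
  ℓ (-(y i) * inner ℝ β (x i)) + lam * r (maxNorm x • β) / n

/-- The subcollection `(C k)_k` of the data points (repetitions allowed), with weights `(u k)_k`,
is an `ε`-coreset of the regularized loss minimization instance `(x, y, ℓ, r, lam)`. -/
def IsCoreset {n d : ℕ} {ι : Type*} [Fintype ι] (ℓ : ℝ → ℝ)
    (r : EuclideanSpace ℝ (Fin d) → ℝ) (lam : ℝ)
    (x : Fin n → EuclideanSpace ℝ (Fin d)) (y : Fin n → ℝ) (ε : ℝ)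
    (C : ι → Fin n) (u : ι → ℝ) : Prop :=
  (∀ k, 0 ≤ u k) ∧
  ∀ β : EuclideanSpace ℝ (Fin d),
    |∑ i, pointCost ℓ r lam x y i β - ∑ k, u k * pointCost ℓ r lam x y (C k) β|
      / ∑ i, pointCost ℓ r lam x y i β ≤ ε

/-- The law of `q` independent draws from `Fin n`, each uniform. -/
def uniformSample (n q : ℕ) : Measure (Fin q → Fin n) :=
  Measure.pi fun _ => uniformOn Set.univ

end RLM

end

/-!
Dividing by `max 1 ‖b‖`, the value at `b` of the loss and of its regularizer becomes the value of a
positively homogeneous function on the unit ball of `E × ℝ`. The homogeneous losses are Lipschitz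
there, even though `b` ranges over all of `E`, because `ℓ z - z * ℓ' z` stays in `[0, ℓ 0]`. On that
ball the normalized regularized mean loss `D` is at least of order `1 / S`: where the regularizer is
small the mean loss is bounded below. So a Bernstein bound, relative to `D`, controls the sampling
error on a coarse net at scale `1 / √S` with only `S / ε ^ 2` samples (up to the metric entropy),
and Hoeffding bounds along the links of a chain of nets, whose lengths halve at each level, control
the rest. The nets are chosen greedily, by increasing `D`, so that passing to a net point never
increases `D`, and the relative error at the coarsest net point is also a relative error at the
original parameter.
-/

namespace RLM

section Sampling

variable {Ω : Type*} [MeasurableSpace Ω] {P : Measure Ω} {q : ℕ}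

/-- The deviation of the mean of `φ` over the sample `C` from its mean under `P`. -/
noncomputable def sampleDev (P : Measure Ω) (C : Fin q → Ω) (φ : Ω → ℝ) : ℝ :=
  (∑ k, φ (C k)) / q - ∫ ω, φ ω ∂P

lemma sampleDev_sub (C : Fin q → Ω) {φ ψ : Ω → ℝ} (hφ : Integrable φ P) (hψ : Integrable ψ P) :
    sampleDev P C (fun ω => φ ω - ψ ω) = sampleDev P C φ - sampleDev P C ψ := by
  simp only [sampleDev, Finset.sum_sub_distrib, integral_sub hφ hψ]
  ring

lemma sampleDev_const_mul (C : Fin q → Ω) (c : ℝ) (φ : Ω → ℝ) :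
    sampleDev P C (fun ω => c * φ ω) = c * sampleDev P C φ := by
  simp only [sampleDev, ← Finset.mul_sum, integral_const_mul]
  ring

lemma sum_sub_integral_eq (hq : 0 < q) (C : Fin q → Ω) (φ : Ω → ℝ) :
    ∑ k, (φ (C k) - ∫ ω, φ ω ∂P) = q * sampleDev P C φ := by
  have : (0 : ℝ) < q := by exact_mod_cast hq
  simp only [sampleDev, Finset.sum_sub_distrib, Finset.sum_const, Finset.card_univ,
    Fintype.card_fin, nsmul_eq_mul]
  field_simp

variable [IsProbabilityMeasure P]

lemma measureReal_pi_le_sum_le_exp {ψ : Ω → ℝ} {θ κ : ℝ} (hθ : 0 ≤ θ)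
    (hint : Integrable (fun ω => Real.exp (θ * ψ ω)) P) (hmgf : mgf ψ P θ ≤ Real.exp κ) (a : ℝ) :
    (Measure.pi fun _ : Fin q => P).real {C | a ≤ ∑ k, ψ (C k)} ≤ Real.exp (q * κ - θ * a) := by
  have hexp : (fun C : Fin q → Ω => Real.exp (θ * ∑ k, ψ (C k))) =
      fun C => ∏ k, Real.exp (θ * ψ (C k)) := by
    simp only [Finset.mul_sum, Real.exp_sum]
  have hmgf_sum : mgf (fun C : Fin q → Ω => ∑ k, ψ (C k)) (Measure.pi fun _ => P) θ =
      mgf ψ P θ ^ q := by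
    rw [mgf, hexp, integral_fintype_prod_eq_pow (fun ω => Real.exp (θ * ψ ω)), Fintype.card_fin,
      mgf]
  calc (Measure.pi fun _ : Fin q => P).real {C | a ≤ ∑ k, ψ (C k)}
      ≤ Real.exp (-θ * a) * mgf ψ P θ ^ q := by
        rw [← hmgf_sum]
        refine measure_ge_le_exp_mul_mgf a hθ ?_
        rw [hexp]
        exact Integrable.fintype_prod fun _ => hint
    _ ≤ Real.exp (-θ * a) * Real.exp κ ^ q := by
        gcongr
        exact mgf_nonneg
    _ = Real.exp (q * κ - θ * a) := by
        rw [← Real.exp_nat_mul, ← Real.exp_add]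
        ring_nf

lemma measureReal_pi_lt_abs_sampleDev_le (hq : 0 < q) {φ : Ω → ℝ} {θ κ : ℝ} (hθ : 0 ≤ θ)
    (hint : ∀ ρ, |ρ| = θ → Integrable (fun ω => Real.exp (ρ * (φ ω - P[φ]))) P)
    (hmgf : ∀ ρ, |ρ| = θ → mgf (fun ω => φ ω - P[φ]) P ρ ≤ Real.exp κ) (s : ℝ) :
    (Measure.pi fun _ : Fin q => P).real {C | s < |sampleDev P C φ|} ≤
      2 * Real.exp (-(q * (θ * s - κ))) := by
  have hupper := measureReal_pi_le_sum_le_exp (q := q) hθ (hint θ (abs_of_nonneg hθ))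
    (hmgf θ (abs_of_nonneg hθ)) (q * s)
  have hneg : |-θ| = θ := by rw [abs_neg, abs_of_nonneg hθ]
  have hlower := measureReal_pi_le_sum_le_exp (P := P) (q := q) (ψ := -fun ω => φ ω - P[φ]) hθ
    (by simpa only [Pi.neg_apply, mul_neg, neg_mul] using hint (-θ) hneg)
    (by simpa only [mgf_neg] using hmgf (-θ) hneg) (q * s)
  have hsub : {C : Fin q → Ω | s < |sampleDev P C φ|} ⊆
      {C | q * s ≤ ∑ k, (φ (C k) - P[φ])} ∪
        {C | q * s ≤ ∑ k, (-fun ω => φ ω - P[φ]) (C k)} := by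
    intro C hC
    have hC : s < |sampleDev P C φ| := hC
    simp only [Set.mem_union, Set.mem_ofPred_eq, Pi.neg_apply, Finset.sum_neg_distrib,
      sum_sub_integral_eq hq, ← mul_neg]
    exact (lt_abs.1 hC).imp (fun h => mul_le_mul_of_nonneg_left h.le q.cast_nonneg)
      fun h => mul_le_mul_of_nonneg_left h.le q.cast_nonneg
  calc (Measure.pi fun _ : Fin q => P).real {C | s < |sampleDev P C φ|}
      ≤ Real.exp (q * κ - θ * (q * s)) + Real.exp (q * κ - θ * (q * s)) :=
        (measureReal_mono hsub).trans ((measureReal_union_le _ _).trans (add_le_add hupper hlower))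
    _ = 2 * Real.exp (-(q * (θ * s - κ))) := by
        rw [← two_mul]
        ring_nf

lemma measureReal_pi_lt_abs_sampleDev_le_of_abs_le (hq : 0 < q) {φ : Ω → ℝ} (hφ : Measurable φ)
    {B s : ℝ} (hB : 0 < B) (hs : 0 ≤ s) (hφB : ∀ ω, |φ ω| ≤ B) :
    (Measure.pi fun _ : Fin q => P).real {C | s < |sampleDev P C φ|} ≤
      2 * Real.exp (-(q * (s ^ 2 / (2 * B ^ 2)))) := by
  have hsubG := hasSubgaussianMGF_of_mem_Icc (μ := P) (a := -B) (b := B) hφ.aemeasurable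
    (Filter.Eventually.of_forall fun ω => abs_le.1 (hφB ω))
  have hvar : (((‖B - -B‖₊ / 2) ^ 2 : NNReal) : ℝ) = B ^ 2 := by
    push_cast
    rw [sub_neg_eq_add, Real.norm_of_nonneg (by positivity), add_self_div_two]
  refine (measureReal_pi_lt_abs_sampleDev_le (θ := s / B ^ 2) (κ := B ^ 2 * (s / B ^ 2) ^ 2 / 2)
    hq (by positivity) (fun ρ _ => hsubG.integrable_exp_mul ρ) (fun ρ hρ => ?_) s).trans_eq ?_
  · rw [← hρ, sq_abs, ← hvar]
    exact hsubG.mgf_le ρ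
  · congr 3
    field_simp
    ring

lemma exp_le_one_add_add_sq_of_abs_le {y : ℝ} (hy : |y| ≤ 3 / 7) :
    Real.exp y ≤ 1 + y + 7 / 12 * y ^ 2 := by
  have htaylor := (abs_le.1 (Real.exp_bound (x := y) (n := 4) (by linarith) (by norm_num))).2
  simp only [Finset.sum_range_succ, Finset.sum_range_zero, Nat.factorial,
    Even.pow_abs (by decide : Even 4)] at htaylor
  norm_num at htaylor
  have hy2 : 0 ≤ y ^ 2 * (3 / 7 - y) := mul_nonneg (sq_nonneg y) (sub_nonneg.2 (abs_le.1 hy).2)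
  have hy2' : 0 ≤ y + 3 / 7 := by linarith [(abs_le.1 hy).1]
  nlinarith [mul_nonneg hy2 hy2', mul_nonneg (sq_nonneg y) hy2']

lemma exp_mul_le_one_add {t y : ℝ} (ht₀ : 0 ≤ t) (ht₁ : t ≤ 1) (hy : |y| ≤ 3 / 7) :
    Real.exp (t * y) ≤ 1 + t * (y + 7 / 12 * y ^ 2) := by
  have hconvex := convexOn_exp.2 (Set.mem_univ 0) (Set.mem_univ y) (sub_nonneg.2 ht₁) ht₀
    (sub_add_cancel 1 t)
  simp only [smul_eq_mul, mul_zero, zero_add, Real.exp_zero, mul_one] at hconvex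
  linarith [mul_le_mul_of_nonneg_left (exp_le_one_add_add_sq_of_abs_le hy) ht₀]

lemma mgf_sub_integral_le_exp {φ : Ω → ℝ} (hφ : Measurable φ) {M y : ℝ} (hM : 0 < M)
    (hφM : ∀ ω, φ ω ∈ Set.Icc 0 M) (hy : |y| ≤ 3 / 7) :
    mgf (fun ω => φ ω - P[φ]) P (y / M) ≤ Real.exp (7 / 12 * y ^ 2 * (P[φ] / M)) := by
  have hae : ∀ᵐ ω ∂P, φ ω ∈ Set.Icc 0 M := Filter.Eventually.of_forall hφM
  have hφ_int : Integrable φ P := Integrable.of_mem_Icc 0 M hφ.aemeasurable hae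
  have hpointwise : ∀ ω, Real.exp (y / M * φ ω) ≤ 1 + φ ω * ((y + 7 / 12 * y ^ 2) / M) := by
    intro ω
    convert! exp_mul_le_one_add (div_nonneg (hφM ω).1 hM.le) ((div_le_one hM).2 (hφM ω).2) hy
      using 2 <;> ring
  have hmgf : mgf φ P (y / M) ≤ Real.exp (P[φ] * ((y + 7 / 12 * y ^ 2) / M)) := by
    calc mgf φ P (y / M) ≤ ∫ ω, 1 + φ ω * ((y + 7 / 12 * y ^ 2) / M) ∂P :=
          integral_mono (integrable_exp_mul_of_mem_Icc hφ.aemeasurable hae)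
            ((integrable_const 1).add (hφ_int.mul_const _)) hpointwise
      _ = P[φ] * ((y + 7 / 12 * y ^ 2) / M) + 1 := by
          rw [integral_add (integrable_const 1) (hφ_int.mul_const _), integral_mul_const]
          simp [add_comm]
      _ ≤ _ := Real.add_one_le_exp _
  calc mgf (fun ω => φ ω - P[φ]) P (y / M) = mgf φ P (y / M) * Real.exp (y / M * -P[φ]) :=
        mgf_add_const (-P[φ])
    _ ≤ Real.exp (P[φ] * ((y + 7 / 12 * y ^ 2) / M)) * Real.exp (y / M * -P[φ]) := by gcongr
    _ = Real.exp (7 / 12 * y ^ 2 * (P[φ] / M)) := by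
        rw [← Real.exp_add]
        ring_nf

lemma measureReal_pi_mul_lt_abs_sampleDev_le (hq : 0 < q) {φ : Ω → ℝ} (hφ : Measurable φ)
    {M D u : ℝ} (hM : 0 < M) (hφM : ∀ ω, φ ω ∈ Set.Icc 0 M) (hD : P[φ] ≤ D) (hu₀ : 0 ≤ u)
    (hu₁ : u ≤ 1 / 2) :
    (Measure.pi fun _ : Fin q => P).real {C | u * D < |sampleDev P C φ|} ≤
      2 * Real.exp (-(q * (3 / 7 * (D / M) * u ^ 2))) := by
  have hsubG := hasSubgaussianMGF_of_mem_Icc (μ := P) hφ.aemeasurable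
    (Filter.Eventually.of_forall hφM)
  -- `t = 6 / 7 * u` maximizes the Chernoff exponent `t * u - 7 / 12 * t ^ 2`, with value
  -- `3 / 7 * u ^ 2`; it is at most `3 / 7` because `u ≤ 1 / 2`.
  refine (measureReal_pi_lt_abs_sampleDev_le (θ := 6 / 7 * u / M)
    (κ := 7 / 12 * (6 / 7 * u) ^ 2 * (D / M)) hq (by positivity)
    (fun ρ _ => hsubG.integrable_exp_mul ρ) (fun ρ hρ => ?_) (u * D)).trans_eq ?_
  · have hρM : |ρ * M| = 6 / 7 * u := by
      rw [abs_mul, hρ, abs_of_pos hM, div_mul_cancel₀ _ hM.ne']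
    calc mgf (fun ω => φ ω - P[φ]) P ρ = mgf (fun ω => φ ω - P[φ]) P (ρ * M / M) := by
          rw [mul_div_cancel_right₀ _ hM.ne']
      _ ≤ Real.exp (7 / 12 * (ρ * M) ^ 2 * (P[φ] / M)) :=
          mgf_sub_integral_le_exp hφ hM hφM (by linarith)
      _ ≤ Real.exp (7 / 12 * (6 / 7 * u) ^ 2 * (D / M)) := by
          rw [← hρM, sq_abs]
          gcongr
  · congr 3
    field_simp
    ring

end Sampling

section Nets

variable {X α : Type*}

lemma exists_separated_net [PseudoMetricSpace X] [LinearOrder α] (D : X → α) {η : ℝ} (hη : 0 ≤ η)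
    (F : Finset X) :
    ∃ A ⊆ F, (A : Set X).Pairwise (fun a b => η < dist a b) ∧
      ∀ p ∈ F, ∃ a ∈ A, dist p a ≤ η ∧ D a ≤ D p := by
  classical
  induction F using Finset.strongInduction with
  | H F ih =>
    rcases F.eq_empty_or_nonempty with rfl | hF
    · exact ⟨∅, by simp⟩
    obtain ⟨c, hc, hmin⟩ := F.exists_min_image D hF
    have hfar_ssubset : F.filter (fun p => η < dist p c) ⊂ F :=
      Finset.filter_ssubset.2 ⟨c, hc, by simpa using hη⟩
    obtain ⟨A, hA, hsep, hcov⟩ := ih _ hfar_ssubset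
    refine ⟨insert c A, Finset.insert_subset hc (hA.trans (Finset.filter_subset _ _)), ?_, ?_⟩
    · rw [Finset.coe_insert]
      refine hsep.insert fun a ha _ => ?_
      have hac : η < dist a c := (Finset.mem_filter.1 (hA ha)).2
      exact ⟨dist_comm a c ▸ hac, hac⟩
    · intro p hp
      by_cases hpc : η < dist p c
      · obtain ⟨a, ha, hpa⟩ := hcov p (Finset.mem_filter.2 ⟨hp, hpc⟩)
        exact ⟨a, Finset.mem_insert_of_mem ha, hpa⟩
      · exact ⟨c, Finset.mem_insert_self _ _, not_lt.1 hpc, hmin p hp⟩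

/-- A sequence of nets `A j` of `F`, separated at scale `η j`, together with maps `π j` that move
each point of `F` by at most `η j` into `A j`, to a point at which `D` is no larger. -/
structure IsNetChain [PseudoMetricSpace X] [LE α] (F : Finset X) (D : X → α) (η : ℕ → ℝ)
    (A : ℕ → Finset X) (π : ℕ → X → X) : Prop where
  subset : ∀ j, A j ⊆ F
  separated : ∀ j, (A j : Set X).Pairwise fun a b => η j < dist a b
  proj_mem : ∀ j, ∀ p ∈ F, π j p ∈ A j
  dist_proj_le : ∀ j, ∀ p ∈ F, dist p (π j p) ≤ η j
  proj_le : ∀ j, ∀ p ∈ F, D (π j p) ≤ D p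

lemma exists_isNetChain [PseudoMetricSpace X] [LinearOrder α] (F : Finset X) (D : X → α)
    {η : ℕ → ℝ} (hη : ∀ j, 0 ≤ η j) : ∃ A π, IsNetChain F D η A π := by
  choose A hsubset hsep hcov using fun j => exists_separated_net D (hη j) F
  have hproj : ∀ j p, ∃ a, p ∈ F → a ∈ A j ∧ dist p a ≤ η j ∧ D a ≤ D p := by
    intro j p
    by_cases hp : p ∈ F
    · obtain ⟨a, ha⟩ := hcov j p hp
      exact ⟨a, fun _ => ha⟩
    · exact ⟨p, fun h => absurd h hp⟩
  choose π hπ using hproj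
  exact ⟨A, π, hsubset, hsep, fun j p hp => (hπ j p hp).1, fun j p hp => (hπ j p hp).2.1,
    fun j p hp => (hπ j p hp).2.2⟩

namespace IsNetChain

variable {F : Finset X} {η : ℕ → ℝ} {A : ℕ → Finset X} {π : ℕ → X → X}

lemma eventually_subset [MetricSpace X] [LE α] {D : X → α} (h : IsNetChain F D η A π)
    (hη : Filter.Tendsto η Filter.atTop (nhds 0)) : ∀ᶠ j in Filter.atTop, F ⊆ A j := by
  have hsmall : ∀ᶠ j in Filter.atTop, ∀ p ∈ F, ∀ a ∈ F, p ≠ a → η j < dist p a := by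
    simp only [Filter.eventually_all_finset, Filter.eventually_imp_distrib_left]
    exact fun p _ a _ hpa => hη.eventually_lt_const (dist_pos.2 hpa)
  filter_upwards [hsmall] with j hj p hp
  have hmem := h.proj_mem j p hp
  have heq : p = π j p := by
    by_contra hne
    exact (h.dist_proj_le j p hp).not_gt (hj p hp _ (h.subset j hmem) hne)
  exact heq ▸ hmem

lemma abs_le_add_sum [PseudoMetricSpace X] {D : X → ℝ} (h : IsNetChain F D η A π) {g : X → ℝ}
    {s : ℕ → ℝ} (hcoarse : ∀ p ∈ A 0, |g p| ≤ D p) {J : ℕ}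
    (hlink : ∀ j < J, ∀ p ∈ A (j + 1), |g p - g (π j p)| ≤ s j) :
    ∀ p ∈ A J, |g p| ≤ D p + ∑ j ∈ Finset.range J, s j := by
  induction J with
  | zero => simpa using hcoarse
  | succ J ih =>
    intro p hp
    have hpF := h.subset _ hp
    have hproj := ih (fun j hj => hlink j (by omega)) _ (h.proj_mem J p hpF)
    have htriangle : |g p| ≤ |g p - g (π J p)| + |g (π J p)| := by
      simpa using abs_add_le (g p - g (π J p)) (g (π J p))
    rw [Finset.sum_range_succ]
    linarith [h.proj_le J p hpF, hlink J J.lt_succ_self p hp]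

lemma measureReal_exists_lt_abs_le [MetricSpace X] {D : X → ℝ} (h : IsNetChain F D η A π)
    (hη : Filter.Tendsto η Filter.atTop (nhds 0)) {Ω : Type*} [MeasurableSpace Ω] {Q : Measure Ω}
    [IsFiniteMeasure Q] (g : X → Ω → ℝ) {s t : ℕ → ℝ} {t₀ σ : ℝ}
    (hcoarse : ∀ p ∈ A 0, Q.real {ω | D p < |g p ω|} ≤ t₀)
    (hlink : ∀ j, ∀ p ∈ A (j + 1), Q.real {ω | s j < |g p ω - g (π j p) ω|} ≤ t j)
    (hσ : ∀ J, ∑ j ∈ Finset.range J, s j ≤ σ) :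
    ∃ J, Q.real {ω | ∃ p ∈ F, D p + σ < |g p ω|} ≤
      (A 0).card * t₀ + ∑ j ∈ Finset.range J, (A (j + 1)).card * t j := by
  obtain ⟨J, hJ⟩ := (h.eventually_subset hη).exists
  refine ⟨J, ?_⟩
  let coarse : Set Ω := ⋃ p ∈ A 0, {ω | D p < |g p ω|}
  let link : ℕ → Set Ω := fun j => ⋃ p ∈ A (j + 1), {ω | s j < |g p ω - g (π j p) ω|}
  have hsub : {ω | ∃ p ∈ F, D p + σ < |g p ω|} ⊆ coarse ∪ ⋃ j ∈ Finset.range J, link j := by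
    rintro ω ⟨p, hp, hlarge⟩
    by_contra hgood
    simp only [coarse, link, Set.mem_union, Set.mem_iUnion, Set.mem_ofPred_eq, exists_prop, not_or,
      not_exists, not_and, not_lt, Finset.mem_range] at hgood
    linarith [h.abs_le_add_sum (g := (g · ω)) hgood.1 hgood.2 p (hJ hp), hσ J]
  have hcoarse_le : Q.real coarse ≤ (A 0).card * t₀ := by
    rw [← nsmul_eq_mul]
    exact (measureReal_biUnion_finset_le _ _).trans (Finset.sum_le_card_nsmul _ _ _ hcoarse)
  have hlink_le : ∀ j ∈ Finset.range J, Q.real (link j) ≤ (A (j + 1)).card * t j := by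
    intro j _
    rw [← nsmul_eq_mul]
    exact (measureReal_biUnion_finset_le _ _).trans (Finset.sum_le_card_nsmul _ _ _ (hlink j))
  calc Q.real {ω | ∃ p ∈ F, D p + σ < |g p ω|}
      ≤ Q.real coarse + Q.real (⋃ j ∈ Finset.range J, link j) :=
        (measureReal_mono hsub).trans (measureReal_union_le _ _)
    _ ≤ (A 0).card * t₀ + ∑ j ∈ Finset.range J, (A (j + 1)).card * t j :=
        add_le_add hcoarse_le
          ((measureReal_biUnion_finset_le _ _).trans (Finset.sum_le_sum hlink_le))

end IsNetChain

open Metric Module in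
lemma card_le_of_separated_of_norm_le_one {E : Type*} [NormedAddCommGroup E] [NormedSpace ℝ E]
    [FiniteDimensional ℝ E] {A : Finset E} {η : ℝ} (hη : 0 < η) (hA : ∀ a ∈ A, ‖a‖ ≤ 1)
    (hsep : (A : Set E).Pairwise fun a b => η < dist a b) :
    (A.card : ℝ) ≤ (1 + 2 / η) ^ finrank ℝ E := by
  borelize E
  let vol : Measure E := Measure.addHaar
  have hvol : ∀ (c : E) {ρ : ℝ}, 0 < ρ →
      vol.real (ball c ρ) = ρ ^ finrank ℝ E * vol.real (ball 0 1) := by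
    intro c ρ hρ
    simp only [measureReal_def, vol.addHaar_ball_of_pos c hρ, ENNReal.toReal_mul,
      ENNReal.toReal_ofReal (pow_nonneg hρ.le _)]
  have hη2 : 0 < η / 2 := by positivity
  have hdisj : (A : Set E).Pairwise (Function.onFun Disjoint fun a => ball a (η / 2)) := by
    intro a ha b hb hab
    exact ball_disjoint_ball (by linarith [hsep ha hb hab])
  have hsub : (⋃ a ∈ A, ball a (η / 2)) ⊆ ball (0 : E) (1 + η / 2) := by
    refine Set.iUnion₂_subset fun a ha => ball_subset_ball' ?_
    rw [dist_zero_right]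
    linarith [hA a ha]
  have hpack : A.card * ((η / 2) ^ finrank ℝ E * vol.real (ball 0 1)) ≤
      (1 + η / 2) ^ finrank ℝ E * vol.real (ball 0 1) := by
    calc A.card * ((η / 2) ^ finrank ℝ E * vol.real (ball 0 1))
        = vol.real (⋃ a ∈ A, ball a (η / 2)) := by
          rw [measureReal_biUnion_finset hdisj fun _ _ => measurableSet_ball]
          simp only [hvol _ hη2, Finset.sum_const, nsmul_eq_mul]
      _ ≤ vol.real (ball (0 : E) (1 + η / 2)) := measureReal_mono hsub
      _ = _ := hvol 0 (by positivity)
  have hunit : 0 < vol.real (ball (0 : E) 1) :=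
    ENNReal.toReal_pos (measure_ball_pos vol _ one_pos).ne' measure_ball_lt_top.ne
  rw [← mul_assoc, mul_le_mul_iff_left₀ hunit, ← le_div_iff₀ (by positivity), ← div_pow] at hpack
  convert! hpack using 2
  field_simp
  ring

end Nets

section UniformDeviation

/-- The scale of the `j`-th net in the chaining argument; the constant is chosen so that the net has
at most `√S ^ ((3 + j) * v)` points in dimension `v`. -/
noncomputable def netScale (S : ℝ) (j : ℕ) : ℝ := 9 / 25 / √S * (1 / 2) ^ j

/-- The deviation allowed along a link of level `j` in the chaining argument. It decreases more
slowly than `netScale`, which leaves room for a union bound over the links. -/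
noncomputable def linkThreshold (ε S : ℝ) (j : ℕ) : ℝ := 5 / 8 * ε / S * (2 / 3) ^ j

variable {S ε δ : ℝ} {q v : ℕ}

lemma netScale_pos (hS : 0 < S) (j : ℕ) : 0 < netScale S j := by
  unfold netScale
  positivity

lemma tendsto_netScale (S : ℝ) : Filter.Tendsto (netScale S) Filter.atTop (nhds 0) := by
  rw [← mul_zero (9 / 25 / √S)]
  exact (tendsto_pow_atTop_nhds_zero_of_lt_one (by norm_num) (by norm_num)).const_mul _

lemma le_sqrt_of_six_le (hS : 6 ≤ S) : 2.449 ≤ √S :=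
  Real.le_sqrt_of_sq_le (by linarith)

lemma one_add_two_div_netScale_le (hS : 6 ≤ S) (j : ℕ) : 1 + 2 / netScale S j ≤ √S ^ (3 + j) := by
  have hS₀ : 0 < S := by linarith
  have hsqrt : 2.449 ≤ √S := le_sqrt_of_six_le hS
  have htwo : (1 : ℝ) ≤ 2 ^ j := one_le_pow₀ one_le_two
  calc 1 + 2 / netScale S j = 1 + 50 / 9 * √S * 2 ^ j := by
        rw [netScale, one_div, inv_pow]
        field_simp
        ring
    _ ≤ 6 * √S * 2 ^ j := by nlinarith
    _ ≤ √S ^ 2 * √S * √S ^ j := by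
        rw [Real.sq_sqrt hS₀.le]
        gcongr
        linarith
    _ = √S ^ (3 + j) := by ring

lemma sum_range_pow_le {x : ℝ} (hx₀ : 0 ≤ x) (hx₁ : x < 1) (J : ℕ) :
    ∑ j ∈ Finset.range J, x ^ j ≤ (1 - x)⁻¹ := by
  simpa only [Finset.range_eq_Ico, pow_zero, one_div] using
    geom_sum_Ico_le_of_lt_one (m := 0) (n := J) hx₀ hx₁

lemma sum_linkThreshold_le (hε : 0 ≤ ε) (hS : 0 ≤ S) (J : ℕ) :
    ∑ j ∈ Finset.range J, linkThreshold ε S j ≤ 15 / 8 * ε / S := by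
  calc ∑ j ∈ Finset.range J, linkThreshold ε S j
      = 5 / 8 * ε / S * ∑ j ∈ Finset.range J, (2 / 3 : ℝ) ^ j := by
        simp only [linkThreshold, Finset.mul_sum]
    _ ≤ 5 / 8 * ε / S * (1 - 2 / 3)⁻¹ := by
        gcongr
        exact sum_range_pow_le (by norm_num) (by norm_num) J
    _ = 15 / 8 * ε / S := by ring

lemma linkThreshold_sq_div (hS : 0 < S) (j : ℕ) :
    linkThreshold ε S j ^ 2 / (2 * (2 * netScale S j) ^ 2) =
      15625 / 41472 * (ε ^ 2 / S) * (16 / 9) ^ j := by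
  have hratio : (16 / 9 : ℝ) ^ j = ((2 / 3) ^ j / (1 / 2) ^ j) ^ 2 := by
    rw [← div_pow, ← pow_mul, mul_comm j, pow_mul]
    norm_num
  have hsqrt : √S ^ 2 = S := Real.sq_sqrt hS.le
  have : √S ≠ 0 := (Real.sqrt_pos.2 hS).ne'
  rw [hratio, linkThreshold, netScale]
  generalize ((1 / 2 : ℝ)) ^ j = x
  generalize ((2 / 3 : ℝ)) ^ j = z
  field_simp
  rw [hsqrt]
  ring

lemma exp_neg_half_mul_eq (hS : 0 < S) (hδ : 0 < δ) (v k : ℕ) :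
    Real.exp (-(k / 2 * (v * Real.log S + Real.log (1 / δ)))) = ((√S)⁻¹ ^ v * √δ) ^ k := by
  have hbase : (√S)⁻¹ ^ v * √δ = Real.exp (v * -Real.log √S + Real.log √δ) := by
    rw [Real.exp_add, Real.exp_nat_mul, Real.exp_neg, Real.exp_log (Real.sqrt_pos.2 hS),
      Real.exp_log (Real.sqrt_pos.2 hδ)]
  rw [hbase, ← Real.exp_nat_mul, Real.log_sqrt hS.le, Real.log_sqrt hδ.le, one_div, Real.log_inv]
  ring_nf

lemma card_mul_tail_le {y N : ℝ} {m e k : ℕ} (hy : 1 ≤ y) (hδ₀ : 0 ≤ δ) (hδ₁ : δ ≤ 1) (hv : 0 < v)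
    (hN : N ≤ (y ^ m) ^ v) (hk : m + e ≤ k) (hk₂ : 2 ≤ k) :
    N * (2 * (y⁻¹ ^ v * √δ) ^ k) ≤ 2 * y⁻¹ ^ e * δ := by
  have hy₀ : 0 < y := by linarith
  have hinv₁ : y⁻¹ ≤ 1 := inv_le_one_of_one_le₀ hy
  have hpow : (y ^ m) ^ v * (y⁻¹ ^ v) ^ k ≤ y⁻¹ ^ e := by
    calc (y ^ m) ^ v * (y⁻¹ ^ v) ^ k ≤ (y ^ m) ^ v * (y⁻¹ ^ v) ^ (m + e) := by
          gcongr 1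
          exact pow_le_pow_of_le_one (by positivity) (pow_le_one₀ (by positivity) hinv₁) hk
      _ = (y⁻¹ ^ e) ^ v := by
          rw [← pow_mul, ← pow_mul, ← pow_mul, mul_comm v, add_mul, pow_add, ← mul_assoc,
            ← mul_pow, mul_inv_cancel₀ hy₀.ne', one_pow, one_mul]
      _ ≤ y⁻¹ ^ e := pow_le_of_le_one (by positivity) (pow_le_one₀ (by positivity) hinv₁) hv.ne'
  have hsqrt : √δ ^ k ≤ δ := by
    calc √δ ^ k ≤ √δ ^ 2 :=
          pow_le_pow_of_le_one (Real.sqrt_nonneg δ) (Real.sqrt_le_one.2 hδ₁) hk₂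
      _ = δ := Real.sq_sqrt hδ₀
  calc N * (2 * (y⁻¹ ^ v * √δ) ^ k) ≤ (y ^ m) ^ v * (2 * (y⁻¹ ^ v * √δ) ^ k) := by gcongr
    _ = 2 * ((y ^ m) ^ v * (y⁻¹ ^ v) ^ k) * √δ ^ k := by ring
    _ ≤ 2 * y⁻¹ ^ e * δ := by gcongr

lemma two_mul_add_sum_le_one {h : ℝ} (h₀ : 0 ≤ h) (h₁ : h ≤ 0.41) (J : ℕ) :
    2 * h + ∑ j ∈ Finset.range J, 2 * h ^ (3 + 4 * j) ≤ 1 := by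
  have hcube : h ^ 3 ≤ 0.41 ^ 3 := by gcongr
  have hfourth : h ^ 4 ≤ 1 / 10 := (pow_le_pow_left₀ h₀ h₁ 4).trans (by norm_num)
  have hsum : ∑ j ∈ Finset.range J, 2 * h ^ (3 + 4 * j) ≤ 2 * 0.41 ^ 3 * (1 - 1 / 10)⁻¹ := by
    calc ∑ j ∈ Finset.range J, 2 * h ^ (3 + 4 * j)
        ≤ ∑ j ∈ Finset.range J, 2 * 0.41 ^ 3 * (1 / 10) ^ j := by
          refine Finset.sum_le_sum fun j _ => ?_
          rw [pow_add, pow_mul, ← mul_assoc]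
          gcongr
      _ ≤ 2 * 0.41 ^ 3 * (1 - 1 / 10)⁻¹ := by
          rw [← Finset.mul_sum]
          gcongr
          exact sum_range_pow_le (by norm_num) (by norm_num) J
  norm_num at hsum h₁ ⊢
  linarith

lemma sum_card_mul_tail_le {N : ℕ → ℝ} (hS : 6 ≤ S) (hδ₀ : 0 ≤ δ) (hδ₁ : δ ≤ 1) (hv : 0 < v)
    (hN : ∀ j, N j ≤ (√S ^ (3 + j)) ^ v) (J : ℕ) :
    N 0 * (2 * ((√S)⁻¹ ^ v * √δ) ^ 4) +
      ∑ j ∈ Finset.range J, N (j + 1) * (2 * ((√S)⁻¹ ^ v * √δ) ^ (7 + 5 * j)) ≤ δ := by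
  have hsqrt : 2.449 ≤ √S := le_sqrt_of_six_le hS
  have hsqrt₁ : 1 ≤ √S := by linarith
  calc N 0 * (2 * ((√S)⁻¹ ^ v * √δ) ^ 4) +
        ∑ j ∈ Finset.range J, N (j + 1) * (2 * ((√S)⁻¹ ^ v * √δ) ^ (7 + 5 * j))
      ≤ 2 * (√S)⁻¹ ^ 1 * δ + ∑ j ∈ Finset.range J, 2 * (√S)⁻¹ ^ (3 + 4 * j) * δ :=
        add_le_add (card_mul_tail_le hsqrt₁ hδ₀ hδ₁ hv (hN 0) (by omega) (by omega))
          (Finset.sum_le_sum fun j _ =>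
            card_mul_tail_le hsqrt₁ hδ₀ hδ₁ hv (hN (j + 1)) (by omega) (by omega))
    _ = (2 * (√S)⁻¹ + ∑ j ∈ Finset.range J, 2 * (√S)⁻¹ ^ (3 + 4 * j)) * δ := by
        rw [add_mul, Finset.sum_mul, pow_one]
    _ ≤ δ := mul_le_of_le_one_left hδ₀ (two_mul_add_sum_le_one (by positivity)
        (inv_le_of_inv_le₀ (by norm_num) (by norm_num; linarith)) J)

lemma mul_log_add_log_pos (hS : 1 < S) (hδ₀ : 0 < δ) (hδ₁ : δ < 1) :
    0 < v * Real.log S + Real.log (1 / δ) :=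
  add_pos_of_nonneg_of_pos (mul_nonneg v.cast_nonneg (Real.log_pos hS).le)
    (Real.log_pos (one_lt_one_div hδ₀ hδ₁))

variable {Ω : Type*} [MeasurableSpace Ω] {P : Measure Ω} [IsProbabilityMeasure P]

lemma measureReal_pi_coarse_deviation_le (hS : 1 < S) (hε₀ : 0 < ε) (hε₁ : ε ≤ 1) (hδ₀ : 0 < δ)
    (hδ₁ : δ < 1) (hq : 10 * S / ε ^ 2 * (v * Real.log S + Real.log (1 / δ)) ≤ q) {φ : Ω → ℝ}
    (hφ : Measurable φ) (hφ₂ : ∀ ω, φ ω ∈ Set.Icc 0 2) {D : ℝ} (hmean : P[φ] ≤ D)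
    (hD : 15 / 4 / S ≤ D) :
    (Measure.pi fun _ : Fin q => P).real {C | ε / 2 * D < |sampleDev P C φ|} ≤
      2 * ((√S)⁻¹ ^ v * √δ) ^ 4 := by
  have hS₀ : 0 < S := by linarith
  have hL := mul_log_add_log_pos (v := v) hS hδ₀ hδ₁
  have hq₀ : 0 < q := by exact_mod_cast (show (0 : ℝ) < _ by positivity).trans_le hq
  rw [← exp_neg_half_mul_eq hS₀ hδ₀]
  refine (measureReal_pi_mul_lt_abs_sampleDev_le hq₀ hφ two_pos hφ₂ hmean (by positivity)
    (by linarith)).trans ?_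
  gcongr 2 * Real.exp (-?_)
  calc ((4 : ℕ) : ℝ) / 2 * (v * Real.log S + Real.log (1 / δ))
      ≤ 225 / 112 * (v * Real.log S + Real.log (1 / δ)) := by
        gcongr ?_ * _
        norm_num
    _ = 10 * S / ε ^ 2 * (v * Real.log S + Real.log (1 / δ)) *
          (3 / 7 * (15 / 4 / S / 2) * (ε / 2) ^ 2) := by
        field_simp
        norm_num
    _ ≤ q * (3 / 7 * (D / 2) * (ε / 2) ^ 2) := by gcongr

lemma measureReal_pi_link_deviation_le (hS : 1 < S) (hε₀ : 0 < ε) (hδ₀ : 0 < δ) (hδ₁ : δ < 1)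
    (hq : 10 * S / ε ^ 2 * (v * Real.log S + Real.log (1 / δ)) ≤ q) {ψ : Ω → ℝ}
    (hψ : Measurable ψ) {j : ℕ} (hψ_le : ∀ ω, |ψ ω| ≤ 2 * netScale S j) :
    (Measure.pi fun _ : Fin q => P).real {C | linkThreshold ε S j < |sampleDev P C ψ|} ≤
      2 * ((√S)⁻¹ ^ v * √δ) ^ (7 + 5 * j) := by
  have hS₀ : 0 < S := by linarith
  have hL := mul_log_add_log_pos (v := v) hS hδ₀ hδ₁
  have hq₀ : 0 < q := by exact_mod_cast (show (0 : ℝ) < _ by positivity).trans_le hq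
  have hbernoulli : 1 + (j : ℝ) * (7 / 9) ≤ (16 / 9) ^ j := by
    have := one_add_mul_le_pow (a := (7 / 9 : ℝ)) (by norm_num) j
    norm_num at this ⊢
    exact this
  have : (0 : ℝ) ≤ j := j.cast_nonneg
  rw [← exp_neg_half_mul_eq hS₀ hδ₀]
  refine (measureReal_pi_lt_abs_sampleDev_le_of_abs_le hq₀ hψ
    (mul_pos two_pos (netScale_pos hS₀ j)) (by unfold linkThreshold; positivity) hψ_le).trans ?_
  rw [linkThreshold_sq_div hS₀]
  gcongr 2 * Real.exp (-?_)
  calc ((7 + 5 * j : ℕ) : ℝ) / 2 * (v * Real.log S + Real.log (1 / δ))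
      ≤ 10 * (15625 / 41472) * (16 / 9) ^ j * (v * Real.log S + Real.log (1 / δ)) := by
        gcongr
        push_cast
        linarith
    _ = 10 * S / ε ^ 2 * (v * Real.log S + Real.log (1 / δ)) *
          (15625 / 41472 * (ε ^ 2 / S) * (16 / 9) ^ j) := by
        field_simp
    _ ≤ q * (15625 / 41472 * (ε ^ 2 / S) * (16 / 9) ^ j) := by gcongr

variable {E : Type*} [NormedAddCommGroup E] [NormedSpace ℝ E] [FiniteDimensional ℝ E]

open Module in
theorem measureReal_pi_exists_mul_lt_abs_sampleDev_le [Nontrivial E] {F : Finset E}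
    {φ : E → Ω → ℝ} {D : E → ℝ} (hS : 6 ≤ S) (hε₀ : 0 < ε) (hε₁ : ε ≤ 1) (hδ₀ : 0 < δ) (hδ₁ : δ < 1)
    (hq : 10 * S / ε ^ 2 * (finrank ℝ E * Real.log S + Real.log (1 / δ)) ≤ q)
    (hF : ∀ p ∈ F, ‖p‖ ≤ 1) (hφ : ∀ p ∈ F, Measurable (φ p))
    (hφ₂ : ∀ p ∈ F, ∀ ω, φ p ω ∈ Set.Icc 0 2)
    (hφ_lip : ∀ p ∈ F, ∀ p' ∈ F, ∀ ω, |φ p ω - φ p' ω| ≤ 2 * dist p p')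
    (hmean : ∀ p ∈ F, P[φ p] ≤ D p) (hD : ∀ p ∈ F, 15 / 4 / S ≤ D p) :
    (Measure.pi fun _ : Fin q => P).real {C | ∃ p ∈ F, ε * D p < |sampleDev P C (φ p)|} ≤ δ := by
  have hS₀ : 0 < S := by linarith
  have hS₁ : 1 < S := by linarith
  have hint : ∀ p ∈ F, Integrable (φ p) P := fun p hp =>
    Integrable.of_mem_Icc 0 2 (hφ p hp).aemeasurable (Filter.Eventually.of_forall (hφ₂ p hp))
  obtain ⟨A, π, hA⟩ :=
    exists_isNetChain F (fun p => ε / 2 * D p) fun j => (netScale_pos hS₀ j).le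
  have hcard : ∀ j, ((A j).card : ℝ) ≤ (√S ^ (3 + j)) ^ finrank ℝ E := fun j =>
    (card_le_of_separated_of_norm_le_one (netScale_pos hS₀ j) (fun p hp => hF p (hA.subset j hp))
      (hA.separated j)).trans (by
        have := netScale_pos hS₀ j
        gcongr
        exact one_add_two_div_netScale_le hS j)
  have hlink : ∀ j, ∀ p ∈ A (j + 1), (Measure.pi fun _ : Fin q => P).real
      {C | linkThreshold ε S j < |sampleDev P C (φ p) - sampleDev P C (φ (π j p))|} ≤
        2 * ((√S)⁻¹ ^ finrank ℝ E * √δ) ^ (7 + 5 * j) := by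
    intro j p hp
    have hpF := hA.subset _ hp
    have hπF := hA.subset _ (hA.proj_mem j p hpF)
    simp only [← sampleDev_sub _ (hint p hpF) (hint _ hπF)]
    refine measureReal_pi_link_deviation_le hS₁ hε₀ hδ₀ hδ₁ hq ((hφ p hpF).sub (hφ _ hπF))
      fun ω => (hφ_lip p hpF _ hπF ω).trans ?_
    gcongr
    exact hA.dist_proj_le j p hpF
  obtain ⟨J, hJ⟩ := hA.measureReal_exists_lt_abs_le (tendsto_netScale S)
    (fun p C => sampleDev P C (φ p))
    (fun p hp => measureReal_pi_coarse_deviation_le hS₁ hε₀ hε₁ hδ₀ hδ₁ hq (hφ p (hA.subset 0 hp))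
      (hφ₂ p (hA.subset 0 hp)) (hmean p (hA.subset 0 hp)) (hD p (hA.subset 0 hp)))
    hlink (sum_linkThreshold_le hε₀.le hS₀.le)
  have hsub : {C : Fin q → Ω | ∃ p ∈ F, ε * D p < |sampleDev P C (φ p)|} ⊆
      {C | ∃ p ∈ F, ε / 2 * D p + 15 / 8 * ε / S < |sampleDev P C (φ p)|} := by
    rintro C ⟨p, hp, hdev⟩
    have hslack : 15 / 8 * ε / S ≤ ε / 2 * D p := by
      calc 15 / 8 * ε / S = ε / 2 * (15 / 4 / S) := by ring
        _ ≤ ε / 2 * D p := by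
          gcongr
          exact hD p hp
    exact ⟨p, hp, by linarith⟩
  exact (measureReal_mono hsub).trans
    (hJ.trans (sum_card_mul_tail_le hS hδ₀.le hδ₁.le finrank_pos hcard J))

end UniformDeviation

section Losses

/-- The properties of the logistic and of the hinge loss on which the sampling bound rests. -/
structure IsAdmissibleLoss (ℓ : ℝ → ℝ) : Prop where
  nonneg : ∀ z, 0 ≤ ℓ z
  monotone : Monotone ℓ
  lipschitz : LipschitzWith 1 ℓ
  convex : ConvexOn ℝ Set.univ ℓ
  le_self : ∀ z, z ≤ ℓ z
  zero_le_one : ℓ 0 ≤ 1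
  le_neg_add_sq : ∀ t, 0 ≤ t → 5 / 8 ≤ ℓ (-t) + t ^ 2

lemma hasDerivAt_logisticLoss (z : ℝ) : HasDerivAt logisticLoss (Real.sigmoid z) z := by
  convert! ((Real.hasDerivAt_exp z).const_add 1).log (by positivity) using 1
  rw [Real.sigmoid_def, Real.exp_neg]
  have := Real.exp_pos z
  field_simp
  ring

lemma deriv_logisticLoss : deriv logisticLoss = Real.sigmoid :=
  funext fun z => (hasDerivAt_logisticLoss z).deriv

lemma differentiable_logisticLoss : Differentiable ℝ logisticLoss :=
  fun z => (hasDerivAt_logisticLoss z).differentiableAt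

lemma log_two_sub_half_le_logisticLoss_neg (t : ℝ) :
    Real.log 2 - t / 2 ≤ logisticLoss (-t) := by
  have hamgm : 2 * Real.exp (-(t / 2)) ≤ 1 + Real.exp (-t) := by
    rw [show -t = 2 * -(t / 2) by ring, two_mul (-(t / 2)), Real.exp_add]
    nlinarith [sq_nonneg (Real.exp (-(t / 2)) - 1)]
  calc Real.log 2 - t / 2 = Real.log (2 * Real.exp (-(t / 2))) := by
        rw [Real.log_mul two_ne_zero (Real.exp_ne_zero _), Real.log_exp, ← sub_eq_add_neg]
    _ ≤ logisticLoss (-t) := Real.log_le_log (by positivity) hamgm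

lemma isAdmissibleLoss_logisticLoss : IsAdmissibleLoss logisticLoss where
  nonneg z := Real.log_nonneg (by linarith [Real.exp_pos z])
  monotone z w h := by
    unfold logisticLoss
    gcongr
  lipschitz := lipschitzWith_of_nnnorm_deriv_le differentiable_logisticLoss fun z => by
    rw [deriv_logisticLoss, ← NNReal.coe_le_coe, coe_nnnorm, Real.norm_of_nonneg z.sigmoid_nonneg]
    exact z.sigmoid_le_one
  convex := by
    refine Monotone.convexOn_univ_of_deriv differentiable_logisticLoss ?_
    rw [deriv_logisticLoss]
    exact Real.sigmoid_monotone
  le_self z := by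
    rw [logisticLoss, Real.le_log_iff_exp_le (by positivity)]
    linarith
  zero_le_one := by
    rw [logisticLoss, Real.exp_zero, one_add_one_eq_two]
    linarith [Real.log_two_lt_d9]
  le_neg_add_sq t _ := by
    nlinarith [Real.log_two_gt_d9, sq_nonneg (t - 1 / 4), log_two_sub_half_le_logisticLoss_neg t]

lemma isAdmissibleLoss_hingeLoss : IsAdmissibleLoss hingeLoss where
  nonneg z := le_max_left _ _
  monotone z w h := by
    unfold hingeLoss
    gcongr
  lipschitz := (IsometryEquiv.addLeft (1 : ℝ)).isometry.lipschitz.const_max 0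
  convex := (convexOn_const 0 convex_univ).sup ((convexOn_const 1 convex_univ).add
    (convexOn_id convex_univ))
  le_self z := le_max_of_le_right (by linarith)
  zero_le_one := by simp [hingeLoss]
  le_neg_add_sq t _ := by
    have : 1 + -t ≤ hingeLoss (-t) := le_max_right _ _
    nlinarith [sq_nonneg (t - 1 / 2)]

/-- The perspective of `ℓ`, that is, its extension to a positively homogeneous function of
`(z, s)` with `s > 0`. -/
noncomputable def persp (ℓ : ℝ → ℝ) (z s : ℝ) : ℝ := s * ℓ (z / s)

namespace IsAdmissibleLoss

variable {ℓ : ℝ → ℝ}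

lemma abs_sub_le (h : IsAdmissibleLoss ℓ) (z w : ℝ) : |ℓ z - ℓ w| ≤ |z - w| := by
  simpa [Real.dist_eq] using h.lipschitz.dist_le_mul z w

lemma persp_nonneg (h : IsAdmissibleLoss ℓ) (z : ℝ) {s : ℝ} (hs : 0 ≤ s) : 0 ≤ persp ℓ z s :=
  mul_nonneg hs (h.nonneg _)

lemma abs_persp_sub_left_le (h : IsAdmissibleLoss ℓ) (z w : ℝ) {s : ℝ} (hs : 0 < s) :
    |persp ℓ z s - persp ℓ w s| ≤ |z - w| := by
  have hℓ := h.abs_sub_le (z / s) (w / s)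
  rwa [← sub_div, abs_div, abs_of_pos hs, le_div_iff₀' hs, ← abs_of_pos hs, ← abs_mul, mul_sub,
    abs_of_pos hs] at hℓ

lemma persp_mono_right (h : IsAdmissibleLoss ℓ) (z : ℝ) {s t : ℝ} (hs : 0 < s) (hst : s ≤ t) :
    persp ℓ z s ≤ persp ℓ z t := by
  have ht : 0 < t := hs.trans_le hst
  rcases le_total 0 z with hz | hz
  · have hle : z / t ≤ z / s := div_le_div_of_nonneg_left hz hs hst
    have hlip : ℓ (z / s) ≤ ℓ (z / t) + (z / s - z / t) := by
      linarith [abs_le.1 (h.abs_sub_le (z / s) (z / t)), abs_of_nonneg (sub_nonneg.2 hle)]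
    calc s * ℓ (z / s) ≤ s * (ℓ (z / t) + (z / s - z / t)) := by gcongr
      _ = z + s * (ℓ (z / t) - z / t) := by field_simp; ring
      _ ≤ z + t * (ℓ (z / t) - z / t) := by
        gcongr
        exact sub_nonneg.2 (h.le_self _)
      _ = t * ℓ (z / t) := by field_simp; ring
  · have hle : z / s ≤ z / t := by
      rw [div_le_div_iff₀ hs ht]
      exact mul_le_mul_of_nonpos_left hst hz
    exact mul_le_mul hst (h.monotone hle) (h.nonneg _) ht.le

lemma persp_sub_right_le (h : IsAdmissibleLoss ℓ) (z : ℝ) {s t : ℝ} (hs : 0 < s) (hst : s ≤ t) :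
    persp ℓ z t - persp ℓ z s ≤ t - s := by
  have ht : 0 < t := hs.trans_le hst
  have hconvex : ℓ (z / t) ≤ s / t * ℓ (z / s) + (t - s) / t * ℓ 0 := by
    convert! h.convex.2 (Set.mem_univ (z / s)) (Set.mem_univ 0) (div_nonneg hs.le ht.le)
      (div_nonneg (sub_nonneg.2 hst) ht.le) (by field_simp; ring) using 2
    simp only [smul_eq_mul, mul_zero, add_zero]
    field_simp
  have hzero : (t - s) * ℓ 0 ≤ t - s :=
    mul_le_of_le_one_right (sub_nonneg.2 hst) h.zero_le_one
  calc t * ℓ (z / t) - s * ℓ (z / s)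
      ≤ t * (s / t * ℓ (z / s) + (t - s) / t * ℓ 0) - s * ℓ (z / s) := by gcongr
    _ = (t - s) * ℓ 0 := by field_simp; ring
    _ ≤ t - s := hzero

lemma abs_persp_sub_right_le (h : IsAdmissibleLoss ℓ) (z : ℝ) {s t : ℝ} (hs : 0 < s) (ht : 0 < t) :
    |persp ℓ z s - persp ℓ z t| ≤ |s - t| := by
  wlog hst : s ≤ t generalizing s t
  · rw [abs_sub_comm, abs_sub_comm s]
    exact this ht hs (le_of_not_ge hst)
  rw [abs_sub_comm, abs_of_nonneg (sub_nonneg.2 (h.persp_mono_right z hs hst)), abs_sub_comm,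
    abs_of_nonneg (sub_nonneg.2 hst)]
  exact h.persp_sub_right_le z hs hst

lemma abs_persp_sub_le (h : IsAdmissibleLoss ℓ) (z w : ℝ) {s t : ℝ} (hs : 0 < s) (ht : 0 < t) :
    |persp ℓ z s - persp ℓ w t| ≤ |z - w| + |s - t| :=
  (_root_.abs_sub_le _ (persp ℓ w s) _).trans
    (add_le_add (h.abs_persp_sub_left_le z w hs) (h.abs_persp_sub_right_le w hs ht))

lemma persp_le_two (h : IsAdmissibleLoss ℓ) {z s : ℝ} (hs₀ : 0 < s) (hs₁ : s ≤ 1) (hz : |z| ≤ 1) :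
    persp ℓ z s ≤ 2 := by
  have hzero : persp ℓ 0 s ≤ 1 := by
    rw [persp, zero_div]
    exact mul_le_one₀ hs₁ (h.nonneg 0) h.zero_le_one
  have hsub := (abs_le.1 (h.abs_persp_sub_left_le z 0 hs₀)).2
  rw [sub_zero] at hsub
  linarith

end IsAdmissibleLoss

end Losses

section HomogeneousLoss

variable {E : Type*} [NormedAddCommGroup E]

lemma max_one_norm_pos (b : E) : 0 < max 1 ‖b‖ := one_pos.trans_le (le_max_left _ _)

section Homogenize

variable [NormedSpace ℝ E]

/-- The point of norm one in `E × ℝ` on the ray through `(b, 1)`. A positively homogeneous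
function of a parameter in `E × ℝ` is controlled at all `(b, 1)` by its values at these points. -/
noncomputable def homogenize (b : E) : E × ℝ := ((max 1 ‖b‖)⁻¹ • b, (max 1 ‖b‖)⁻¹)

lemma homogenize_snd_pos (b : E) : 0 < (homogenize b).2 := inv_pos.2 (max_one_norm_pos b)

lemma homogenize_snd_le_one (b : E) : (homogenize b).2 ≤ 1 :=
  inv_le_one_of_one_le₀ (le_max_left _ _)

lemma norm_homogenize_fst (b : E) : ‖(homogenize b).1‖ = (max 1 ‖b‖)⁻¹ * ‖b‖ := by
  rw [homogenize, norm_smul, norm_inv, Real.norm_of_nonneg (max_one_norm_pos b).le]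

lemma norm_homogenize_fst_le_one (b : E) : ‖(homogenize b).1‖ ≤ 1 := by
  rw [norm_homogenize_fst, inv_mul_le_one₀ (max_one_norm_pos b)]
  exact le_max_right _ _

lemma norm_homogenize_le_one (b : E) : ‖homogenize b‖ ≤ 1 :=
  max_le (norm_homogenize_fst_le_one b) <| by
    rw [Real.norm_of_nonneg (homogenize_snd_pos b).le]
    exact homogenize_snd_le_one b

lemma homogenize_of_norm_le_one {b : E} (hb : ‖b‖ ≤ 1) : homogenize b = (b, 1) := by
  rw [homogenize, max_eq_left hb, inv_one, one_smul]

lemma norm_homogenize_fst_of_one_le_norm {b : E} (hb : 1 ≤ ‖b‖) : ‖(homogenize b).1‖ = 1 := by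
  rw [norm_homogenize_fst, max_eq_right hb, inv_mul_cancel₀ (one_pos.trans_le hb).ne']

lemma norm_homogenize_fst_sq (b : E) :
    ‖(homogenize b).1‖ ^ 2 = (max 1 ‖b‖)⁻¹ * min ‖b‖ (‖b‖ ^ 2) := by
  rw [norm_homogenize_fst]
  rcases le_total ‖b‖ 1 with hb | hb
  · rw [max_eq_left hb, min_eq_right (pow_le_of_le_one (norm_nonneg b) hb two_ne_zero)]
    ring
  · have hb₀ : ‖b‖ ≠ 0 := (one_pos.trans_le hb).ne'
    rw [max_eq_right hb, min_eq_left (le_self_pow₀ hb two_ne_zero), inv_mul_cancel₀ hb₀, one_pow]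

end Homogenize

variable [InnerProductSpace ℝ E] {Ω : Type*} {ℓ : ℝ → ℝ} {a : Ω → E}

/-- The loss at the data `a ω`, extended to a positively homogeneous function of the parameter
`w ∈ E × ℝ`, whose value at `(b, 1)` is the loss at `b`. -/
noncomputable def homLoss (ℓ : ℝ → ℝ) (a : Ω → E) (w : E × ℝ) (ω : Ω) : ℝ :=
  persp ℓ (inner ℝ w.1 (a ω)) w.2

lemma homLoss_homogenize (ℓ : ℝ → ℝ) (a : Ω → E) (b : E) :
    homLoss ℓ a (homogenize b) = fun ω => (max 1 ‖b‖)⁻¹ * ℓ (inner ℝ b (a ω)) := by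
  funext ω
  have hb := (max_one_norm_pos b).ne'
  rw [homLoss, persp, homogenize, real_inner_smul_left, mul_div_cancel_left₀ _ (inv_ne_zero hb)]

lemma abs_inner_le_norm_of_norm_le_one {u v : E} (hv : ‖v‖ ≤ 1) : |inner ℝ u v| ≤ ‖u‖ :=
  (abs_real_inner_le_norm u v).trans (mul_le_of_le_one_right (norm_nonneg u) hv)

namespace IsAdmissibleLoss

lemma homLoss_homogenize_mem_Icc (h : IsAdmissibleLoss ℓ) (ha : ∀ ω, ‖a ω‖ ≤ 1) (b : E) (ω : Ω) :
    homLoss ℓ a (homogenize b) ω ∈ Set.Icc 0 2 :=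
  ⟨h.persp_nonneg _ (homogenize_snd_pos b).le,
    h.persp_le_two (homogenize_snd_pos b) (homogenize_snd_le_one b)
      ((abs_inner_le_norm_of_norm_le_one (ha ω)).trans (norm_homogenize_fst_le_one b))⟩

lemma abs_homLoss_sub_le (h : IsAdmissibleLoss ℓ) (ha : ∀ ω, ‖a ω‖ ≤ 1) {w w' : E × ℝ}
    (hw : 0 < w.2) (hw' : 0 < w'.2) (ω : Ω) :
    |homLoss ℓ a w ω - homLoss ℓ a w' ω| ≤ 2 * dist w w' := by
  calc |homLoss ℓ a w ω - homLoss ℓ a w' ω|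
      ≤ |inner ℝ (w.1 - w'.1) (a ω)| + |w.2 - w'.2| := by
        rw [inner_sub_left]
        exact h.abs_persp_sub_le _ _ hw hw'
    _ ≤ dist w.1 w'.1 + dist w.2 w'.2 := by
        rw [dist_eq_norm w.1, Real.dist_eq]
        gcongr
        exact abs_inner_le_norm_of_norm_le_one (ha ω)
    _ ≤ 2 * dist w w' := by
        rw [two_mul]
        exact add_le_add (le_max_left _ _) (le_max_right _ _)

variable [MeasurableSpace E] [BorelSpace E] [MeasurableSpace Ω] {P : Measure Ω}

lemma measurable_homLoss_homogenize (h : IsAdmissibleLoss ℓ) (ha : Measurable a) (b : E) :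
    Measurable (homLoss ℓ a (homogenize b)) := by
  rw [homLoss_homogenize]
  exact ((h.lipschitz.continuous.comp (continuous_const.inner continuous_id)).measurable.comp
    ha).const_mul _

variable [IsProbabilityMeasure P]

lemma five_eighths_mul_le_integral_homLoss_add (h : IsAdmissibleLoss ℓ) (ha : Measurable a)
    (ha₁ : ∀ ω, ‖a ω‖ ≤ 1) {μ : ℝ} (hμ₀ : 0 ≤ μ) (hμ₁ : μ ≤ 1) (b : E) :
    5 / 8 * μ ≤ P[homLoss ℓ a (homogenize b)] + μ * ‖(homogenize b).1‖ ^ 2 := by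
  rcases le_total ‖b‖ 1 with hb | hb
  · have hint : Integrable (homLoss ℓ a (homogenize b)) P :=
      Integrable.of_mem_Icc 0 2 (h.measurable_homLoss_homogenize ha b).aemeasurable
        (Filter.Eventually.of_forall (h.homLoss_homogenize_mem_Icc ha₁ b))
    have hloss : ℓ (-‖b‖) ≤ P[homLoss ℓ a (homogenize b)] := by
      calc ℓ (-‖b‖) = ∫ _, ℓ (-‖b‖) ∂P := by simp only [integral_const, probReal_univ, one_smul]
        _ ≤ P[homLoss ℓ a (homogenize b)] := integral_mono (integrable_const _) hint fun ω => by
          simp only [homLoss_homogenize, max_eq_left hb, inv_one, one_mul]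
          exact h.monotone (abs_le.1 (abs_inner_le_norm_of_norm_le_one (ha₁ ω))).1
    rw [homogenize_of_norm_le_one hb] at hloss ⊢
    nlinarith [mul_le_mul_of_nonneg_left (h.le_neg_add_sq ‖b‖ (norm_nonneg b)) hμ₀,
      mul_le_of_le_one_left (h.nonneg (-‖b‖)) hμ₁]
  · have hloss : 0 ≤ P[homLoss ℓ a (homogenize b)] :=
      integral_nonneg fun ω => (h.homLoss_homogenize_mem_Icc ha₁ b ω).1
    rw [norm_homogenize_fst_of_one_le_norm hb]
    linarith

variable [FiniteDimensional ℝ E] {q : ℕ} {S ε δ : ℝ}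

lemma measureReal_pi_exists_mem_lt_abs_sampleDev_le (h : IsAdmissibleLoss ℓ) (ha : Measurable a)
    (ha₁ : ∀ ω, ‖a ω‖ ≤ 1) (hS : 6 ≤ S) (hε₀ : 0 < ε) (hε₁ : ε ≤ 1) (hδ₀ : 0 < δ) (hδ₁ : δ < 1)
    (hq : 10 * S / ε ^ 2 * ((Module.finrank ℝ E + 1) * Real.log S + Real.log (1 / δ)) ≤ q)
    (B : Finset E) :
    (Measure.pi fun _ : Fin q => P).real
      {C | ∃ b ∈ B, ε * (∫ ω, ℓ (inner ℝ b (a ω)) ∂P + 6 / S * min ‖b‖ (‖b‖ ^ 2)) <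
        |sampleDev P C fun ω => ℓ (inner ℝ b (a ω))|} ≤ δ := by
  classical
  have hS₀ : 0 < S := by linarith
  refine (measureReal_mono ?_).trans (measureReal_pi_exists_mul_lt_abs_sampleDev_le (P := P)
    (F := B.image homogenize) (φ := homLoss ℓ a)
    (D := fun w => P[homLoss ℓ a w] + 6 / S * ‖w.1‖ ^ 2) hS hε₀ hε₁ hδ₀ hδ₁
    (by simpa [Module.finrank_prod] using hq) ?_ ?_ ?_ ?_ ?_ ?_)
  · rintro C ⟨b, hb, hC⟩
    refine ⟨homogenize b, Finset.mem_image_of_mem _ hb, ?_⟩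
    have hb₀ : 0 < (max 1 ‖b‖)⁻¹ := inv_pos.2 (max_one_norm_pos b)
    rw [norm_homogenize_fst_sq, homLoss_homogenize, sampleDev_const_mul, integral_const_mul,
      abs_mul, abs_of_pos hb₀, mul_left_comm (6 / S), ← mul_add, mul_left_comm]
    exact mul_lt_mul_of_pos_left hC hb₀
  all_goals simp only [Finset.forall_mem_image]
  · exact fun b _ => norm_homogenize_le_one b
  · exact fun b _ => h.measurable_homLoss_homogenize ha b
  · exact fun b _ => h.homLoss_homogenize_mem_Icc ha₁ b
  · exact fun b _ b' _ => h.abs_homLoss_sub_le ha₁ (homogenize_snd_pos b) (homogenize_snd_pos b')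
  · exact fun b _ => le_add_of_nonneg_right (by positivity)
  · intro b _
    have hμ : 6 / S ≤ 1 := (div_le_one hS₀).2 hS
    rw [show 15 / 4 / S = 5 / 8 * (6 / S) by ring]
    exact h.five_eighths_mul_le_integral_homLoss_add ha ha₁ (by positivity) hμ b

theorem measureReal_pi_exists_lt_abs_sampleDev_le [Finite Ω] (h : IsAdmissibleLoss ℓ)
    (ha : Measurable a) (ha₁ : ∀ ω, ‖a ω‖ ≤ 1) (hS : 6 ≤ S) (hε₀ : 0 < ε) (hε₁ : ε ≤ 1)
    (hδ₀ : 0 < δ) (hδ₁ : δ < 1)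
    (hq : 10 * S / ε ^ 2 * ((Module.finrank ℝ E + 1) * Real.log S + Real.log (1 / δ)) ≤ q) :
    (Measure.pi fun _ : Fin q => P).real
      {C | ∃ b, ε * (∫ ω, ℓ (inner ℝ b (a ω)) ∂P + 6 / S * min ‖b‖ (‖b‖ ^ 2)) <
        |sampleDev P C fun ω => ℓ (inner ℝ b (a ω))|} ≤ δ := by
  classical
  have := Fintype.ofFinite (Fin q → Ω)
  set bad := {C : Fin q → Ω | ∃ b, ε * (∫ ω, ℓ (inner ℝ b (a ω)) ∂P + 6 / S * min ‖b‖ (‖b‖ ^ 2)) <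
    |sampleDev P C fun ω => ℓ (inner ℝ b (a ω))|}
  choose! b hb using fun C (hC : C ∈ bad) => hC
  exact (h.measureReal_pi_exists_mem_lt_abs_sampleDev_le ha ha₁ hS hε₀ hε₁ hδ₀ hδ₁ hq
    (Finset.univ.image b)).trans' (measureReal_mono fun C hC =>
      ⟨b C, Finset.mem_image_of_mem b (Finset.mem_univ C), hb C hC⟩)

end IsAdmissibleLoss

end HomogeneousLoss

section Coreset

variable {n d q : ℕ} {ℓ : ℝ → ℝ} {r : EuclideanSpace ℝ (Fin d) → ℝ} {lam ε : ℝ}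
  {x : Fin n → EuclideanSpace ℝ (Fin d)} {y : Fin n → ℝ}

lemma isAdmissibleLoss_of_eq_or_eq (hℓ : ℓ = logisticLoss ∨ ℓ = hingeLoss) :
    IsAdmissibleLoss ℓ := by
  rcases hℓ with rfl | rfl
  exacts [isAdmissibleLoss_logisticLoss, isAdmissibleLoss_hingeLoss]

lemma norm_le_oneNorm (b : EuclideanSpace ℝ (Fin d)) : ‖b‖ ≤ oneNorm b := by
  rw [EuclideanSpace.norm_eq, oneNorm]
  refine Real.sqrt_le_iff.2 ⟨Finset.sum_nonneg fun _ _ => abs_nonneg _, ?_⟩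
  simp only [Real.norm_eq_abs]
  exact Finset.sum_sq_le_sq_sum_of_nonneg fun _ _ => abs_nonneg _

lemma min_norm_sq_le_of_eq_or_eq (hr : r = oneNorm ∨ r = twoNorm ∨ r = twoNormSq)
    (b : EuclideanSpace ℝ (Fin d)) : min ‖b‖ (‖b‖ ^ 2) ≤ r b := by
  rcases hr with rfl | rfl | rfl
  exacts [min_le_of_left_le (norm_le_oneNorm b), min_le_left _ _, min_le_right _ _]

lemma norm_le_maxNorm (x : Fin n → EuclideanSpace ℝ (Fin d)) (i : Fin n) : ‖x i‖ ≤ maxNorm x :=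
  le_ciSup (f := fun i => ‖x i‖) (Set.finite_range _).bddAbove i

lemma maxNorm_nonneg (x : Fin n → EuclideanSpace ℝ (Fin d)) : 0 ≤ maxNorm x :=
  Real.iSup_nonneg fun i => norm_nonneg (x i)

/-- The data points scaled to the unit ball and multiplied by minus their labels. They all vanish
when `maxNorm x = 0`. -/
noncomputable def normalizedData (x : Fin n → EuclideanSpace ℝ (Fin d)) (y : Fin n → ℝ)
    (i : Fin n) : EuclideanSpace ℝ (Fin d) :=
  (-(y i) / maxNorm x) • x i

lemma norm_normalizedData_le_one (hy : ∀ i, |y i| ≤ 1) (i : Fin n) :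
    ‖normalizedData x y i‖ ≤ 1 := by
  have hR := maxNorm_nonneg x
  rw [normalizedData, norm_smul, Real.norm_eq_abs, abs_div, abs_neg, abs_of_nonneg hR,
    div_mul_eq_mul_div]
  exact div_le_one_of_le₀
    ((mul_le_of_le_one_left (norm_nonneg _) (hy i)).trans (norm_le_maxNorm x i)) hR

lemma inner_smul_normalizedData (β : EuclideanSpace ℝ (Fin d)) (i : Fin n) :
    inner ℝ (maxNorm x • β) (normalizedData x y i) = -(y i) * inner ℝ β (x i) := by
  rw [normalizedData, real_inner_smul_left, real_inner_smul_right]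
  rcases (maxNorm_nonneg x).eq_or_lt with hR | hR
  · have hx : x i = 0 := norm_le_zero_iff.1 ((norm_le_maxNorm x i).trans_eq hR.symm)
    simp only [hx, inner_zero_right, mul_zero]
  · field_simp

lemma sum_eq_mul_integral_uniformOn_univ (hn : 0 < n) (φ : Fin n → ℝ) :
    ∑ i, φ i = n * ∫ i, φ i ∂(uniformOn Set.univ) := by
  have hn' : (0 : ℝ) < n := by exact_mod_cast hn
  rw [integral_fintype .of_finite]
  simp [measureReal_def, uniformOn_univ, ← Finset.mul_sum, hn'.ne']

lemma sum_pointCost (hn : 0 < n) (β : EuclideanSpace ℝ (Fin d)) :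
    ∑ i, pointCost ℓ r lam x y i β =
      n * (∫ i, ℓ (-(y i) * inner ℝ β (x i)) ∂(uniformOn Set.univ) +
        lam / n * r (maxNorm x • β)) := by
  simp only [pointCost, Finset.sum_add_distrib, Finset.sum_const, Finset.card_univ,
    Fintype.card_fin, nsmul_eq_mul,
    sum_eq_mul_integral_uniformOn_univ hn fun i => ℓ (-(y i) * inner ℝ β (x i))]
  ring

lemma sum_pointCost_sub_sum_mul_pointCost (hn : 0 < n) (hq : 0 < q) (C : Fin q → Fin n)
    (β : EuclideanSpace ℝ (Fin d)) :
    ∑ i, pointCost ℓ r lam x y i β - ∑ k, (n : ℝ) / q * pointCost ℓ r lam x y (C k) β =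
      -(n * sampleDev (uniformOn Set.univ) C fun i => ℓ (-(y i) * inner ℝ β (x i))) := by
  have : (0 : ℝ) < q := by exact_mod_cast hq
  rw [sum_pointCost hn, ← Finset.mul_sum]
  simp only [pointCost, Finset.sum_add_distrib, Finset.sum_const, Finset.card_univ,
    Fintype.card_fin, nsmul_eq_mul, sampleDev]
  field_simp
  ring

lemma isCoreset_of_abs_sampleDev_le (hn : 0 < n) (hq : 0 < q) (hℓ : ∀ z, 0 ≤ ℓ z)
    (hr : ∀ b, 0 ≤ r b) (hlam : 0 ≤ lam) (hε : 0 ≤ ε) (C : Fin q → Fin n)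
    (hC : ∀ β, |sampleDev (uniformOn Set.univ) C fun i => ℓ (-(y i) * inner ℝ β (x i))| ≤
      ε * (∫ i, ℓ (-(y i) * inner ℝ β (x i)) ∂(uniformOn Set.univ) +
        lam / n * r (maxNorm x • β))) :
    IsCoreset ℓ r lam x y ε C fun _ => (n : ℝ) / q := by
  refine ⟨fun _ => by positivity, fun β => div_le_of_le_mul₀ ?_ hε ?_⟩
  · exact Finset.sum_nonneg fun i _ => add_nonneg (hℓ _) (by have := hr (maxNorm x • β); positivity)
  · rw [sum_pointCost_sub_sum_mul_pointCost hn hq, sum_pointCost hn, abs_neg, abs_mul, Nat.abs_cast,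
      mul_left_comm]
    exact mul_le_mul_of_nonneg_left (hC β) n.cast_nonneg

end Coreset

end RLM

theorem mainTheorem2_general {n d q : ℕ} (hn : 0 < n) {x : Fin n → EuclideanSpace ℝ (Fin d)}
    {y : Fin n → ℝ} (hy : ∀ i, |y i| ≤ 1) {ℓ : ℝ → ℝ} (hℓ : RLM.IsAdmissibleLoss ℓ)
    {r : EuclideanSpace ℝ (Fin d) → ℝ} (hr : ∀ b, min ‖b‖ (‖b‖ ^ 2) ≤ r b) {lam : ℝ}
    (hlam : 0 < lam) {S : ℝ} (hS : 6 ≤ S) (hSlam : 6 * n / lam ≤ S) {ε δ : ℝ} (hε₀ : 0 < ε)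
    (hε₁ : ε ≤ 1) (hδ₀ : 0 < δ) (hδ₁ : δ < 1)
    (hq : 10 * S / ε ^ 2 * ((d + 1) * Real.log S + Real.log (1 / δ)) ≤ q) :
    1 - δ ≤ (RLM.uniformSample n q).real
      {C | RLM.IsCoreset ℓ r lam x y ε C fun _ => (n : ℝ) / q} := by
  have : NeZero n := ⟨hn.ne'⟩
  have hn' : (0 : ℝ) < n := by exact_mod_cast hn
  have hS₀ : 0 < S := by linarith
  have hSlam' : 6 / S ≤ lam / n := by
    rw [div_le_iff₀ hlam] at hSlam
    rw [div_le_div_iff₀ hS₀ hn', mul_comm lam]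
    exact hSlam
  have hq₀ : 0 < q := by
    have hlog := RLM.mul_log_add_log_pos (v := d + 1) (by linarith : 1 < S) hδ₀ hδ₁
    push_cast at hlog
    have hq' : (0 : ℝ) < q := (mul_pos (by positivity) hlog).trans_le hq
    exact_mod_cast hq'
  have hdev := hℓ.measureReal_pi_exists_lt_abs_sampleDev_le (P := uniformOn Set.univ)
    (Measurable.of_discrete (f := RLM.normalizedData x y)) (RLM.norm_normalizedData_le_one hy)
    hS hε₀ hε₁ hδ₀ hδ₁ (by rwa [finrank_euclideanSpace_fin])
  refine (sub_le_sub_left hdev 1).trans ?_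
  rw [← probReal_compl_eq_one_sub (Set.toFinite _).measurableSet]
  refine measureReal_mono fun C hC => ?_
  refine RLM.isCoreset_of_abs_sampleDev_le hn hq₀ hℓ.nonneg
    (fun b => (hr b).trans' (by positivity)) hlam.le hε₀.le C fun β => ?_
  simp only [Set.mem_compl_iff, Set.mem_ofPred_eq, not_exists, not_lt] at hC
  have hβ := hC (RLM.maxNorm x • β)
  simp only [RLM.inner_smul_normalizedData] at hβ
  refine hβ.trans ?_
  gcongr
  exact hr _

theorem mainTheorem2 {n d : ℕ} (hn : 0 < n)
    (x : Fin n → EuclideanSpace ℝ (Fin d))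
    (y : Fin n → ℝ) (hy : ∀ i, y i = -1 ∨ y i = 1)
    (ℓ : ℝ → ℝ) (hℓ : ℓ = RLM.logisticLoss ∨ ℓ = RLM.hingeLoss)
    (r : EuclideanSpace ℝ (Fin d) → ℝ)
    (hr : r = RLM.oneNorm ∨ r = RLM.twoNorm ∨ r = RLM.twoNormSq)
    (lam : ℝ) (hlam : 0 < lam)
    (S' : ℝ) (hS' : S' = 12 * n / lam + 6)
    (ε δ : ℝ) (hε : 0 < ε) (hε1 : ε < 1) (hδ : 0 < δ) (hδ1 : δ < 1) :
    (∀ κ : ℝ, 0 < κ → κ < 1 → lam = (n : ℝ) ^ κ → S' = 12 * (n : ℝ) ^ (1 - κ) + 6) ∧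
    ∀ q : ℕ, 10 * S' / ε ^ 2 * ((d + 1) * Real.log S' + Real.log (1 / δ)) ≤ q →
      1 - δ ≤ (RLM.uniformSample n q).real
        {C | RLM.IsCoreset ℓ r lam x y ε C (fun _ => (n : ℝ) / q)} := by
  have hn' : (0 : ℝ) < n := by exact_mod_cast hn
  have hratio : 0 < n / lam := by positivity
  refine ⟨fun κ _ _ hκ => ?_, fun q hq => ?_⟩
  · rw [hS', hκ, Real.rpow_sub hn', Real.rpow_one, mul_div_assoc]
  · have hy₁ : ∀ i, |y i| ≤ 1 := fun i => by rcases hy i with h | h <;> simp [h]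
    rw [mul_div_assoc] at hS'
    exact mainTheorem2_general hn hy₁ (RLM.isAdmissibleLoss_of_eq_or_eq hℓ)
      (RLM.min_norm_sq_le_of_eq_or_eq hr) hlam (by linarith)
      (by rw [mul_div_assoc]; linarith) hε hε1.le hδ hδ1 hq
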